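/- **Setting.** Let $\beta>0$, $\Theta=[-\beta,\beta]$, and let $\theta^*\in\Theta$ be the unknown parameter. At a query point $\theta$ a human compares two candidates, one on the left and one on the right of $\theta$, and selects the right one (answer $+1$) with probability $p^+(\theta)\in[0,1]$, otherwise the left one (answer $-1$). Here $p^+$ is an arbitrary function (for example, in a random utility model with utility $u$, scale $\gamma>0$ and candidates $c^-(\theta)<\theta<c^+(\theta)$, $p^+(\theta)=1/(1+\exp(-(u(c^+(\theta))-u(c^-(\theta)))/\gamma))$). The single-comparison accuracy is $\tilde p(\theta)=p^+(\theta)$ if $\theta\le\theta^*$ and $\tilde p(\theta)=1-p^+(\theta)$ if $\theta>\theta^*$. **Algorithm MAPB.** Inputs: $\delta\in(0,1)$, $\varepsilon>0$, $a>0$, $\eta\in(0,1)$, $p\in(1/2,1-\eta/2)$, a probability density $\rho_0$ on $[-\beta,\beta]$ that is positive everywhere there, a horizontal rule $\tau^{\rightarrow}(\cdot,\cdot)$ and an arbitrary early termination rule $\tau^{\uparrow}(\cdot,\cdot)\in\mathbb N\cup\{\infty\}$. Put $\hbar_m=(2m(\ln(m+1)-\ln\eta))^{1/2}$. For $k=0,1,2,\dots$,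 let $\theta_k$ be the median of $\rho_k$ and collect answers $Z_{k,1},Z_{k,2},\dots\in\{\pm1\}$ to comparisons at $\theta_k$; given all earlier answers, each new answer is $+1$ with probability $p^+(\theta_k)$. Let $S_{k,s}=\sum_{i\le s}Z_{k,i}$. After the $s$-th answer: if $k\ge\tau^{\rightarrow}(\delta/2,a)$ and $s\ge\tau^{\uparrow}(\delta/2,\varepsilon)$, the algorithm terminates; otherwise, if $|S_{k,s}|\ge\hbar_s$, the test at $\theta_k$ stops, and the density is updated: $\rho_{k+1}(x)=2p\rho_k(x)$ on the side of $\theta_k$ indicated by the sign of $S_{k,s}$ and $\rho_{k+1}(x)=2(1-p)\rho_k(x)$ on the other side (the point $\theta_k$ itself counts as right). If then $k+1\ge\tau^{\rightarrow}(\delta,\varepsilon)$, the algorithm terminates; otherwise it continues with $k+1$. Let $T$ be the total number of comparisons collected before termination ($T=\infty$ if it never terminates). The horizontal rule is $$\tau^{\rightarrow}(\delta,\varepsilon)=\left\lceil\max\left\{\frac{4\varsigma(1+\varsigma)\log\!\big(\tfrac{8|\theta^*|}{\delta\varepsilon^{\varsigma}}\big)}{r_2\alpha},\ \frac{2\log(8\beta_1/\delta)}{r_1},\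 \frac{\log(8\beta_2/\delta)}{r_R}\right\}\right\rceil,$$ where $\varsigma\in(0,1]$, $\alpha,r_1,r_2,r_R,\beta_2>0$, $\beta_1\ge1$ are arbitrary constants, and for $\theta^*=0$ the first entry is dropped. Put $\phi(x)=c_1|2x-1|^{-2}\ln(|2x-1|^{-1})+c_2$. **Theorem (sample complexity when $p_{low}$ exists).** For every $\eta\in(0,1)$ there are constants $c_1,c_2>0$, depending only on $\eta$, such that the following holds for all $\beta>0$, all constants $\varsigma,\alpha,r_1,r_2,r_R,\beta_1,\beta_2$ as above, and all $p_{low}>1/2$. 1. Suppose $\tilde p(\theta)\ge p_{low}$ for all $\theta\in\Theta\setminus\{\theta^*\}$, and either $\tilde p(\theta^*)\ge p_{low}$ as well, or almost surely the algorithm never queries $\theta^*$. Then, for all inputs as above, $$\mathbb E[T]\le\tau^{\rightarrow}(\delta,\varepsilon)\cdot\phi(p_{low}).$$ 2. $\tau^{\rightarrow}(\delta,\varepsilon)\cdot\phi(p_{low})=O(\log(1/(\delta\varepsilon)))$: there is a constant $C>0$, independent of $\delta,\varepsilon$ and $\theta^*$, such that $\tau^{\rightarrow}(\delta,\varepsilon)\,\phi(p_{low})\le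 C\log(1/(\delta\varepsilon))$ for all $\theta^*\in\Theta$, $\delta\in(0,1)$, $\varepsilon\in(0,1]$ with $\delta\varepsilon\le 1/2$. -/

import Mathlib

open MeasureTheory

namespace MAPB

/-- The vertical threshold `ħ_m = (2 m (ln (m + 1) - ln η))^{1/2}` of the power-one test. -/
noncomputable def threshold (η : ℝ) (m : ℕ) : ℝ :=
  Real.sqrt (2 * m * (Real.log (m + 1) - Real.log η))

/-- `φ(p) = c₁ |2p - 1|^{-2} ln (|2p - 1|^{-1}) + c₂`. -/
noncomputable def phi (c₁ c₂ p : ℝ) : ℝ :=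
  c₁ * (|2 * p - 1| ^ 2)⁻¹ * Real.log (|2 * p - 1|⁻¹) + c₂

/-- The constants that enter the horizontal stopping rule. -/
structure RateConsts where
  ς : ℝ
  α : ℝ
  r₁ : ℝ
  r₂ : ℝ
  rR : ℝ
  β₁ : ℝ
  β₂ : ℝ

/-- The admissible values of the constants. Here `β₁` is the prefactor of an exponential bound on
the probability of an event that is certain at time `0`, so it is at least `1`. -/
structure RateConsts.Admissible (K : RateConsts) : Prop where
  ς_pos : 0 < K.ς
  ς_le : K.ς ≤ 1
  α_pos : 0 < K.α
  r₁_pos : 0 < K.r₁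
  r₂_pos : 0 < K.r₂
  rR_pos : 0 < K.rR
  one_le_β₁ : 1 ≤ K.β₁
  β₂_pos : 0 < K.β₂

/-- The number `τ^→(δ, ε)` of horizontal moves (rounded up to an integer). When `θs = 0` the first
entry of the maximum is `0` instead of `-∞`; the second entry is positive for `δ < 1`, so this does
not change the maximum. -/
noncomputable def tauHor (K : RateConsts) (θs δ ε : ℝ) : ℕ :=
  ⌈max (max
      (4 * K.ς * (1 + K.ς) * Real.log (8 * |θs| / (δ * ε ^ K.ς)) / (K.r₂ * K.α))
      (2 * Real.log (8 * K.β₁ / δ) / K.r₁))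
      (Real.log (8 * K.β₂ / δ) / K.rR)⌉₊

/-- `ρ` is a probability density on `[-β, β]` that is positive everywhere there. -/
structure IsPriorDensity (β : ℝ) (ρ : ℝ → ℝ) : Prop where
  integrable : Integrable ρ
  pos : ∀ x ∈ Set.Icc (-β) β, 0 < ρ x
  zero : ∀ x ∉ Set.Icc (-β) β, ρ x = 0
  integral_eq : ∫ x, ρ x = 1

/-- The median of a density. -/
noncomputable def median (ρ : ℝ → ℝ) : ℝ :=
  sInf {x | 1 / 2 ≤ ∫ y in Set.Iic x, ρ y}

open Classical in
/-- The update of the density after the test at `θ` has decided for the right side (`right = true`)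
or for the left side (`right = false`), where `q = 1 - p`. -/
noncomputable def updateDensity (p θ : ℝ) (right : Bool) (ρ : ℝ → ℝ) : ℝ → ℝ := fun x =>
  if right then (if θ ≤ x then 2 * p * ρ x else 2 * (1 - p) * ρ x)
  else (if θ ≤ x then 2 * (1 - p) * ρ x else 2 * p * ρ x)

/-- The input of the algorithm: confidence level, precision, local parameter, test parameter `η`,
update parameter `p`, horizontal rule `τ^→(·, ·)`, rule `τ^↑(·, ·)` for early termination (value
`⊤`: no early termination), and prior density. -/
structure Input where
  δ : ℝ
  ε : ℝ
  a : ℝ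
  η : ℝ
  p : ℝ
  tauHor : ℝ → ℝ → ℕ
  tauUp : ℝ → ℝ → ℕ∞
  ρ₀ : ℝ → ℝ

/-- A state of the algorithm: the number `k` of completed horizontal moves, the number `s` of
comparisons collected so far at the current query point, the random walk `S = S_{k,s}`, the
current density `ρ_k`, and whether the algorithm has terminated. -/
structure State where
  k : ℕ
  s : ℕ
  S : ℤ
  ρ : ℝ → ℝ
  halted : Prop

/-- The current query point `θ_k`; once the algorithm has terminated, this is its output. -/
noncomputable def State.query (st : State) : ℝ := median st.ρ

def init (A : Input) : State := ⟨0, 0, 0, A.ρ₀, False⟩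

open Classical in
/-- One comparison. The answer `ans` is `true` if the right candidate `c_Δ^+(θ_k)` is selected
(sign `+1`), and `false` if the left candidate `c_Δ^-(θ_k)` is selected (sign `-1`). -/
noncomputable def step (A : Input) (st : State) (ans : Bool) : State :=
  if st.halted then st
  else
    let s' := st.s + 1
    let S' := st.S + (if ans then 1 else -1)
    if A.tauHor (A.δ / 2) A.a ≤ st.k ∧ A.tauUp (A.δ / 2) A.ε ≤ (s' : ℕ∞) then
      ⟨st.k, s', S', st.ρ, True⟩
    else if threshold A.η s' ≤ |(S' : ℝ)| then
      ⟨st.k + 1, 0, 0, updateDensity A.p st.query (decide (0 < S')) st.ρ,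
        A.tauHor A.δ A.ε ≤ st.k + 1⟩
    else ⟨st.k, s', S', st.ρ, False⟩

/-- The state after the first `n` answers of the sequence `y`. -/
noncomputable def stateAt (A : Input) (y : ℕ → Bool) : ℕ → State
  | 0 => init A
  | n + 1 => step A (stateAt A y n) (y n)

/-- The number of comparisons collected before termination (`⊤` if there is no termination). -/
noncomputable def numComparisons (A : Input) (y : ℕ → Bool) : ℕ∞ :=
  ⨅ (n : ℕ) (_ : (stateAt A y n).halted), (n : ℕ∞)

/-- The accuracy of a single comparison at `θ`, if the right candidate is selected with
probability `pPlus θ`: the probability that the answer points in the direction of `θs`. -/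
noncomputable def accuracy (pPlus : ℝ → unitInterval) (θs θ : ℝ) : ℝ :=
  if θ ≤ θs then (pPlus θ : ℝ) else 1 - (pPlus θ : ℝ)

/-- `Y n` is the answer to the `n`-th comparison in a run of the algorithm: as long as the algorithm
has not terminated, the next answer is, conditionally on all the previous ones, `true` with
probability `pPlus θ`, where `θ` is the current query point. -/
structure IsRun {Ω : Type*} [MeasurableSpace Ω] (P : Measure Ω) (A : Input)
    (pPlus : ℝ → unitInterval) (Y : ℕ → Ω → Bool) : Prop where
  measurable : ∀ n, Measurable (Y n)
  law : ∀ (n : ℕ) (h : ℕ → Bool), ¬ (stateAt A h n).halted →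
    P {ω | (∀ i < n, Y i ω = h i) ∧ Y n ω = true} =
      P {ω | ∀ i < n, Y i ω = h i} * ENNReal.ofReal (pPlus (stateAt A h n).query)

end MAPB

namespace MAPB

open Finset

/-! With N = τ^→(δ, ε), the proof is a potential argument. Let D = 2 pLow - 1, and let σ be the
direction of θ*. While the algorithm runs, the potential is (N - 1 - k)Φ + (2/D)(B - σS) + s. One
comparison raises σS by at least D on average and s by 1, so the potential falls by at least 1
(`runPotential_drift`). A linear bound ħ_s + 1 ≤ B + (D/2)s (`threshold_le`) keeps it nonnegative.
When a test stops, whether its verdict is right or wrong, the reset costs at most (2/D)B ≤ Φ, and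
the counter k pays for it (`potential_step_bounds`). Hence E[T] is at most the initial potential, so
at most NΦ, and `offset_le_phi` lets Φ be φ(pLow). Induction on a finite horizon over answer
histories replaces optional stopping. For the second claim, each entry of the maximum is at most a
constant plus a multiple of log(1/(δε)), which is bounded below. -/

/-! ### Linear bounds on the threshold. -/

theorem threshold_zero (η : ℝ) : threshold η 0 = 0 := by simp [threshold]

/-- A linear upper bound for the threshold of the power-one test. -/
theorem threshold_le {η D : ℝ} (hη₀ : 0 < η) (hη₁ : η < 1) (hD₀ : 0 < D) (hD₁ : D ≤ 1) (s : ℕ) :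
    threshold η s ≤ 2 / D * (Real.log 8 + 2 * Real.log D⁻¹ - Real.log η) + D / 2 * s := by
  have hs : (0 : ℝ) ≤ s := s.cast_nonneg
  set L := Real.log (s + 1) - Real.log η with hL
  have hL₀ : 0 ≤ L := by
    have h1 : 0 ≤ Real.log ((s : ℝ) + 1) := Real.log_nonneg (by linarith)
    have h2 : Real.log η < 0 := Real.log_neg hη₀ hη₁
    linarith
  -- Tangent bound log x ≤ x - 1 at x = D²(s + 1)/8; after multiplication by 2/D the slope is D/4,
  -- half of the allowed D/2.
  have hlog : Real.log ((s : ℝ) + 1) ≤ Real.log 8 + 2 * Real.log D⁻¹ + D ^ 2 / 8 * s := by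
    have h1 : Real.log (D ^ 2 / 8 * ((s : ℝ) + 1)) ≤ D ^ 2 / 8 * ((s : ℝ) + 1) - 1 :=
      Real.log_le_sub_one_of_pos (by positivity)
    rw [Real.log_mul (by positivity) (by positivity), Real.log_div (by positivity) (by norm_num),
      Real.log_pow] at h1
    rw [Real.log_inv]
    push_cast at h1
    nlinarith
  -- AM-GM for √(2sL), weighted to spend the other D/4.
  have hsqrt : threshold η s ≤ D / 4 * s + 2 / D * L := by
    refine Real.sqrt_le_iff.mpr ⟨by positivity, ?_⟩
    have h : (D / 4 * s + 2 / D * L) ^ 2 - 2 * s * L = (D / 4 * s - 2 / D * L) ^ 2 := by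
      field_simp
      ring
    nlinarith [sq_nonneg (D / 4 * s - 2 / D * L)]
  have hmul : 2 / D * L ≤
      2 / D * (Real.log 8 + 2 * Real.log D⁻¹ + D ^ 2 / 8 * s - Real.log η) := by
    gcongr
    linarith
  have hsplit : 2 / D * (Real.log 8 + 2 * Real.log D⁻¹ + D ^ 2 / 8 * s - Real.log η) =
      2 / D * (Real.log 8 + 2 * Real.log D⁻¹ - Real.log η) + D / 4 * s := by
    field_simp
    ring
  linarith

/-- A bound on the expected duration of one test. -/
theorem offset_le_phi {η D : ℝ} (hη₀ : 0 < η) (hη₁ : η < 1) (hD₀ : 0 < D) (hD₁ : D ≤ 1) :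
    2 / D * (1 + 2 / D * (Real.log 8 + 2 * Real.log D⁻¹ - Real.log η)) ≤
      (8 + 2 * (2 + 4 * Real.log 8 - 4 * Real.log η)) * (D ^ 2)⁻¹ * Real.log D⁻¹ +
        4 * (2 + 4 * Real.log 8 - 4 * Real.log η) := by
  set b := 2 + 4 * Real.log 8 - 4 * Real.log η with hb
  have hb₀ : 0 < b := by
    have h1 : 0 ≤ Real.log 8 := Real.log_nonneg (by norm_num)
    have h2 : Real.log η < 0 := Real.log_neg hη₀ hη₁
    linarith
  have hinv : 1 ≤ D⁻¹ := (one_le_inv₀ hD₀).mpr hD₁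
  have hl : 0 ≤ Real.log D⁻¹ := Real.log_nonneg hinv
  -- Absorbs the terms without a logarithm: if D⁻¹ ≤ 2 the constant 4 suffices, otherwise log D⁻¹ ≥
  -- 1/2.
  have key : D⁻¹ ^ 2 ≤ 2 * (D⁻¹ ^ 2 * Real.log D⁻¹) + 4 := by
    rcases le_total D⁻¹ 2 with h | h
    · have : 0 ≤ D⁻¹ ^ 2 * Real.log D⁻¹ := by positivity
      nlinarith
    · have h2 : 1 / 2 ≤ Real.log D⁻¹ := by
        have := Real.log_le_log (by norm_num) h
        linarith [Real.log_two_gt_d9]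
      nlinarith [sq_nonneg D⁻¹]
  have hkey := mul_le_mul_of_nonneg_left key hb₀.le
  have hsq : D⁻¹ ≤ D⁻¹ ^ 2 := by nlinarith
  rw [← inv_pow, div_eq_mul_inv]
  have : 2 * D⁻¹ * (1 + 2 * D⁻¹ * (Real.log 8 + 2 * Real.log D⁻¹ - Real.log η)) =
      2 * D⁻¹ - 2 * D⁻¹ ^ 2 + b * D⁻¹ ^ 2 + 8 * (D⁻¹ ^ 2 * Real.log D⁻¹) := by
    rw [hb]; ring
  rw [this]
  linarith

/-! ### Query points and invariants of the state. -/

theorem median_mem_Icc {β : ℝ} (hβ : 0 < β) {ρ : ℝ → ℝ} (hρ : ∀ x ∉ Set.Icc (-β) β, ρ x = 0) :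
    median ρ ∈ Set.Icc (-β) β := by
  unfold median
  set s := {x | 1 / 2 ≤ ∫ y in Set.Iic x, ρ y} with hs
  have hlow : ∀ x ∈ s, -β ≤ x := by
    intro x hx
    by_contra! hlt
    have h0 : ∫ y in Set.Iic x, ρ y = 0 :=
      setIntegral_eq_zero_of_forall_eq_zero fun y hy =>
        hρ y fun h => by linarith [h.1, Set.mem_Iic.mp hy]
    rw [hs, Set.mem_ofPred_eq, h0] at hx
    norm_num at hx
  rcases s.eq_empty_or_nonempty with he | ⟨x, hx⟩
  -- The default `sInf ∅ = 0` lies in the interval, so the total mass of updated densities never has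
  -- to be tracked.
  · rw [he, Real.sInf_empty]
    exact ⟨by linarith, hβ.le⟩
  · refine ⟨le_csInf ⟨x, hx⟩ hlow, ?_⟩
    rcases le_total x β with hxβ | hxβ
    · exact (csInf_le ⟨-β, hlow⟩ hx).trans hxβ
    · refine csInf_le ⟨-β, hlow⟩ ?_
      have heq : ∫ y in Set.Iic β, ρ y = ∫ y in Set.Iic x, ρ y :=
        (setIntegral_eq_of_subset_of_forall_sdiff_eq_zero measurableSet_Iic
          (Set.Iic_subset_Iic.mpr hxβ) fun y hy => hρ y fun h => hy.2 h.2).symm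
      rw [hs, Set.mem_ofPred_eq, heq]
      exact hx

theorem updateDensity_eq_zero {ρ : ℝ → ℝ} {x : ℝ} (p θ : ℝ) (right : Bool) (hx : ρ x = 0) :
    updateDensity p θ right ρ x = 0 := by
  simp [updateDensity, hx]

theorem stateAt_congr (A : Input) {y z : ℕ → Bool} {n : ℕ} (h : ∀ i < n, y i = z i) :
    stateAt A y n = stateAt A z n := by
  induction n with
  | zero => rfl
  | succ n ih => rw [stateAt, stateAt, ih fun i hi => h i (by omega), h n (by omega)]

/-- The sign of an answer. -/
def answerSign (b : Bool) : ℤ := if b then 1 else -1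

open Classical in
theorem step_eq_ite {A : Input} {st : State} (hh : ¬ st.halted) (b : Bool) :
    step A st b =
      if A.tauHor (A.δ / 2) A.a ≤ st.k ∧ A.tauUp (A.δ / 2) A.ε ≤ ((st.s + 1 : ℕ) : ℕ∞) then
        ⟨st.k, st.s + 1, st.S + answerSign b, st.ρ, True⟩
      else if threshold A.η (st.s + 1) ≤ |((st.S + answerSign b : ℤ) : ℝ)| then
        ⟨st.k + 1, 0, 0, updateDensity A.p st.query (decide (0 < st.S + answerSign b)) st.ρ,
          A.tauHor A.δ A.ε ≤ st.k + 1⟩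
      else ⟨st.k, st.s + 1, st.S + answerSign b, st.ρ, False⟩ := by
  unfold step
  rw [if_neg hh]
  rfl

/-- The invariant of the running algorithm. -/
structure State.Valid (A : Input) (β : ℝ) (st : State) : Prop where
  lt : st.k < A.tauHor A.δ A.ε
  abs_le : |(st.S : ℝ)| ≤ threshold A.η st.s
  zero : ∀ x ∉ Set.Icc (-β) β, st.ρ x = 0

theorem State.Valid.step {A : Input} {β : ℝ} {st : State} (hst : st.Valid A β)
    (hh : ¬ st.halted) (b : Bool) (hb : ¬ (step A st b).halted) : (step A st b).Valid A β := by
  rw [step_eq_ite hh] at hb ⊢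
  split_ifs at hb ⊢ with h1 h2
  · exact absurd trivial hb
  · exact ⟨not_le.mp hb, by simp [threshold_zero],
      fun x hx => updateDensity_eq_zero _ _ _ (hst.zero x hx)⟩
  · exact ⟨hst.lt, (not_le.mp h2).le, hst.zero⟩

theorem halted_of_halted_succ {A : Input} {y : ℕ → Bool} {n : ℕ}
    (h : ¬ (stateAt A y (n + 1)).halted) : ¬ (stateAt A y n).halted := by
  intro hn
  apply h
  rw [stateAt, step, if_pos hn]
  exact hn

theorem valid_stateAt {A : Input} {β : ℝ} (hN : 0 < A.tauHor A.δ A.ε)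
    (hρ : ∀ x ∉ Set.Icc (-β) β, A.ρ₀ x = 0) (y : ℕ → Bool) (n : ℕ)
    (h : ¬ (stateAt A y n).halted) : (stateAt A y n).Valid A β := by
  induction n with
  | zero => exact ⟨hN, by simp [stateAt, init, threshold_zero], hρ⟩
  | succ n ih =>
    exact (ih (halted_of_halted_succ h)).step (halted_of_halted_succ h) _ h

/-! ### The potential and its drift. -/

open Classical in
/-- The sign of the direction in which `θs` lies, seen from `θ`. -/
noncomputable def direction (θs θ : ℝ) : ℝ := if θ ≤ θs then 1 else -1

theorem abs_direction (θs θ : ℝ) : |direction θs θ| = 1 := by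
  unfold direction; split_ifs <;> simp

theorem abs_answerSign (b : Bool) : |(answerSign b : ℝ)| = 1 := by
  cases b <;> simp [answerSign]

/-- The value of the potential before it is set to zero by termination: an upper bound on the
expected number of remaining comparisons. -/
noncomputable def runPotential (N : ℕ) (Φ B D σ : ℝ) (k s : ℕ) (S : ℤ) : ℝ :=
  ((N : ℝ) - 1 - k) * Φ + 2 / D * (B - σ * S) + s

open Classical in
/-- The potential of a state. -/
noncomputable def potential (N : ℕ) (Φ B D θs : ℝ) (st : State) : ℝ :=
  if st.halted then 0 else runPotential N Φ B D (direction θs st.query) st.k st.s st.S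

/-- Termination and the end of a test only lower the potential relative to its continued value, so
the drift need be computed only for `runPotential`. -/
theorem potential_step_bounds {A : Input} {β Φ B D θs : ℝ} {st : State} (hst : st.Valid A β)
    (hh : ¬ st.halted) (hD : 0 < D) (hB₀ : 0 ≤ B) (hΦ : 2 / D * B ≤ Φ)
    (hB : ∀ s : ℕ, threshold A.η s + 1 ≤ B + D / 2 * s) (b : Bool) :
    0 ≤ potential (A.tauHor A.δ A.ε) Φ B D θs (step A st b) ∧
    potential (A.tauHor A.δ A.ε) Φ B D θs (step A st b) ≤
      runPotential (A.tauHor A.δ A.ε) Φ B D (direction θs st.query) st.k (st.s + 1)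
        (st.S + answerSign b) := by
  set N := A.tauHor A.δ A.ε with hN
  have hΦ₀ : 0 ≤ Φ := le_trans (by positivity) hΦ
  have hkN : (st.k : ℝ) + 1 ≤ N := by exact_mod_cast hst.lt
  have hrem : 0 ≤ ((N : ℝ) - 1 - st.k) * Φ := mul_nonneg (by linarith) hΦ₀
  -- The walk was within the threshold before this answer and moves by 1: this is the `+ 1` in `hB`.
  have hwalk : direction θs st.query * ((st.S + answerSign b : ℤ) : ℝ) ≤ B + D / 2 * st.s := by
    refine (le_abs_self _).trans ?_
    rw [abs_mul, abs_direction, one_mul, Int.cast_add]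
    refine (abs_add_le _ _).trans ?_
    rw [abs_answerSign]
    linarith [hst.abs_le, hB st.s]
  have hphase : 0 ≤ 2 / D * (B - direction θs st.query * ((st.S + answerSign b : ℤ) : ℝ)) +
      ((st.s + 1 : ℕ) : ℝ) := by
    have h1 : 2 / D * (-(D / 2 * st.s)) ≤
        2 / D * (B - direction θs st.query * ((st.S + answerSign b : ℤ) : ℝ)) := by
      gcongr
      linarith
    have h2 : 2 / D * (-(D / 2 * st.s)) = -(st.s : ℝ) := by field_simp
    push_cast at h1 h2 ⊢
    linarith
  have hrun : ((N : ℝ) - 1 - st.k) * Φ ≤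
      runPotential N Φ B D (direction θs st.query) st.k (st.s + 1) (st.S + answerSign b) := by
    unfold runPotential
    linarith
  rw [step_eq_ite hh, ← hN]
  split_ifs
  · simp only [potential, if_true]
    exact ⟨le_rfl, hrem.trans hrun⟩
  · by_cases hk : N ≤ st.k + 1
    · simp only [potential, if_pos hk]
      exact ⟨le_rfl, hrem.trans hrun⟩
    · have hk' : (st.k : ℝ) + 1 + 1 ≤ N := by exact_mod_cast not_le.mp hk
      have hrem' : 0 ≤ ((N : ℝ) - 1 - (st.k + 1)) * Φ := mul_nonneg (by linarith) hΦ₀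
      have hBD : 0 ≤ 2 / D * B := by positivity
      simp only [potential, if_neg hk]
      refine ⟨?_, le_trans ?_ hrun⟩
      · simp only [runPotential]
        push_cast
        linarith
      · simp only [runPotential]
        push_cast
        linarith
  · simp only [potential, if_false]
    exact ⟨hrem.trans hrun, le_rfl⟩

/-- The drift of the potential under a comparison of accuracy at least `(1 + D) / 2`. -/
theorem runPotential_drift {N : ℕ} {Φ B D θs θ : ℝ} {pPlus : ℝ → unitInterval} (hD : 0 < D)
    (hacc : (1 + D) / 2 ≤ accuracy pPlus θs θ) (k s : ℕ) (S : ℤ) :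
    1 + (pPlus θ : ℝ) * runPotential N Φ B D (direction θs θ) k (s + 1) (S + answerSign true) +
        (1 - (pPlus θ : ℝ)) *
          runPotential N Φ B D (direction θs θ) k (s + 1) (S + answerSign false) ≤
      runPotential N Φ B D (direction θs θ) k s S := by
  have hdrift : D ≤ direction θs θ * (2 * (pPlus θ : ℝ) - 1) := by
    unfold accuracy at hacc
    unfold direction
    split_ifs at hacc ⊢ <;> linarith
  -- Of these two units, one offsets the growth of s and one pays for the comparison.
  have h2 : 2 ≤ 2 / D * (direction θs θ * (2 * (pPlus θ : ℝ) - 1)) := by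
    calc (2 : ℝ) = 2 / D * D := by field_simp
      _ ≤ _ := by gcongr
  simp only [runPotential, answerSign, if_true, Bool.false_eq_true, if_false]
  push_cast
  linarith

/-! ### Answer histories and their probabilities. -/

/-- The event that the first `n` answers are those of `h`. -/
def cylinder {Ω : Type*} (Y : ℕ → Ω → Bool) (n : ℕ) (h : ℕ → Bool) : Set Ω :=
  {ω | ∀ i < n, Y i ω = h i}

theorem measurableSet_cylinder {Ω : Type*} [MeasurableSpace Ω] {Y : ℕ → Ω → Bool}
    (hY : ∀ n, Measurable (Y n)) (n : ℕ) (h : ℕ → Bool) : MeasurableSet (cylinder Y n h) := by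
  have : cylinder Y n h = ⋂ i, ⋂ (_ : i < n), Y i ⁻¹' {h i} := by
    ext ω; simp [cylinder]
  rw [this]
  exact .iInter fun i => .iInter fun _ => hY i (measurableSet_singleton _)

theorem cylinder_succ_update {Ω : Type*} (Y : ℕ → Ω → Bool) (n : ℕ) (h : ℕ → Bool) (b : Bool) :
    cylinder Y (n + 1) (Function.update h n b) =
      {ω | (∀ i < n, Y i ω = h i) ∧ Y n ω = b} := by
  ext ω
  simp only [cylinder, Set.mem_ofPred_eq, Nat.forall_lt_succ_right, Function.update_self]
  refine and_congr_left fun _ => forall₂_congr fun i hi => ?_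
  rw [Function.update_of_ne hi.ne]

theorem cylinder_eq_union {Ω : Type*} (Y : ℕ → Ω → Bool) (n : ℕ) (h : ℕ → Bool) :
    cylinder Y n h = cylinder Y (n + 1) (Function.update h n true) ∪
      cylinder Y (n + 1) (Function.update h n false) := by
  ext ω
  simp only [cylinder_succ_update, Set.mem_union, Set.mem_ofPred_eq, ← and_or_left]
  cases Y n ω <;> simp [cylinder]

theorem stateAt_succ_update (A : Input) (h : ℕ → Bool) (n : ℕ) (b : Bool) :
    stateAt A (Function.update h n b) (n + 1) = step A (stateAt A h n) b := by
  rw [stateAt, Function.update_self,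
    stateAt_congr A fun i hi => Function.update_of_ne (ne_of_lt hi) b h]

section Run

variable {Ω : Type*} [MeasurableSpace Ω] {P : Measure Ω} {A : Input} {pPlus : ℝ → unitInterval}
  {Y : ℕ → Ω → Bool}

theorem IsRun.measure_cylinder_true (hY : IsRun P A pPlus Y) {n : ℕ} {h : ℕ → Bool}
    (hh : ¬ (stateAt A h n).halted) :
    P (cylinder Y (n + 1) (Function.update h n true)) =
      P (cylinder Y n h) * ENNReal.ofReal (pPlus (stateAt A h n).query) := by
  rw [cylinder_succ_update]
  exact hY.law n h hh

theorem IsRun.measure_cylinder_false [IsProbabilityMeasure P] (hY : IsRun P A pPlus Y) {n : ℕ}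
    {h : ℕ → Bool} (hh : ¬ (stateAt A h n).halted) :
    P (cylinder Y (n + 1) (Function.update h n false)) =
      P (cylinder Y n h) * ENNReal.ofReal (1 - pPlus (stateAt A h n).query) := by
  have hdisj : Disjoint (cylinder Y (n + 1) (Function.update h n true))
      (cylinder Y (n + 1) (Function.update h n false)) := by
    rw [cylinder_succ_update, cylinder_succ_update, Set.disjoint_left]
    rintro ω ⟨_, h1⟩ ⟨_, h2⟩
    simp [h1] at h2
  have hsum := measure_union (μ := P) hdisj (measurableSet_cylinder hY.measurable _ _)
  rw [← cylinder_eq_union, hY.measure_cylinder_true hh] at hsum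
  set q := (pPlus (stateAt A h n).query : ℝ)
  have hq₀ : 0 ≤ q := (pPlus _).2.1
  have hq₁ : q ≤ 1 := (pPlus _).2.2
  have hone : ENNReal.ofReal q + ENNReal.ofReal (1 - q) = 1 := by
    rw [← ENNReal.ofReal_add hq₀ (by linarith)]
    simp
  have hsplit : P (cylinder Y n h) = P (cylinder Y n h) * ENNReal.ofReal q +
      P (cylinder Y n h) * ENNReal.ofReal (1 - q) := by
    rw [← mul_add, hone, mul_one]
  refine (ENNReal.add_right_inj (a := P (cylinder Y n h) * ENNReal.ofReal q)
    (ENNReal.mul_ne_top (measure_ne_top _ _) ENNReal.ofReal_ne_top)).mp ?_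
  rw [← hsum, ← hsplit]

/-! ### Expected number of comparisons. -/

open Classical in
/-- The indicator of the event that the `n`-th comparison takes place. -/
noncomputable def running (A : Input) (y : ℕ → Bool) (n : ℕ) : ENNReal :=
  if (stateAt A y n).halted then 0 else 1

theorem running_of_halted {y : ℕ → Bool} {n : ℕ} (h : (stateAt A y n).halted) (m : ℕ) :
    running A y (n + m) = 0 := by
  have : (stateAt A y (n + m)).halted := by
    induction m with
    | zero => exact h
    | succ m ih => exact not_not.mp fun hn => halted_of_halted_succ hn ih
  rw [running, if_pos this]

theorem numComparisons_le_tsum (A : Input) (y : ℕ → Bool) :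
    (numComparisons A y : ENNReal) ≤ ∑' n, running A y n := by
  classical
  by_cases hex : ∃ n, (stateAt A y n).halted
  · calc (numComparisons A y : ENNReal) ≤ ((Nat.find hex : ℕ∞) : ENNReal) :=
          ENat.toENNReal_mono (iInf₂_le (Nat.find hex) (Nat.find_spec hex))
      _ = ∑ n ∈ range (Nat.find hex), running A y n := by
          have : ∀ n ∈ range (Nat.find hex), running A y n = 1 := fun n hn =>
            if_neg (Nat.find_min hex (mem_range.mp hn))
          rw [sum_congr rfl this]
          simp
      _ ≤ _ := ENNReal.sum_le_tsum _
  · push Not at hex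
    have : ∑' n, running A y n = ⊤ := by
      simp only [running, if_neg (hex _)]
      exact ENNReal.tsum_const_eq_top_of_ne_zero one_ne_zero
    rw [this]
    exact le_top

/-- The indicator factors through the first n answers, which take values in a finite discrete space.
-/
theorem measurable_running (hY : ∀ n, Measurable (Y n)) (n : ℕ) :
    Measurable fun ω => running A (fun i => Y i ω) n := by
  let ext : (Fin n → Bool) → ℕ → Bool := fun v i => if hi : i < n then v ⟨i, hi⟩ else false
  have heq : (fun ω => running A (fun i => Y i ω) n) =
      (fun v => running A (ext v) n) ∘ fun ω (i : Fin n) => Y i ω := by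
    funext ω
    simp only [Function.comp, running]
    rw [stateAt_congr A (z := ext fun i : Fin n => Y i ω) fun i hi => by simp [ext, hi]]
  rw [heq]
  exact (measurable_of_countable _).comp (measurable_pi_lambda _ fun i => hY i)

/-- The expected number of comparisons after a given history is at most the potential. -/
theorem IsRun.setLIntegral_running_le [IsProbabilityMeasure P] (hY : IsRun P A pPlus Y)
    {β Φ B D θs : ℝ} (hN : 0 < A.tauHor A.δ A.ε) (hρ : ∀ x ∉ Set.Icc (-β) β, A.ρ₀ x = 0)
    (hD : 0 < D) (hB₀ : 0 ≤ B) (hΦ : 2 / D * B ≤ Φ)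
    (hB : ∀ s : ℕ, threshold A.η s + 1 ≤ B + D / 2 * s)
    (hacc : ∀ n h, P (cylinder Y n h) ≠ 0 → ¬ (stateAt A h n).halted →
      (1 + D) / 2 ≤ accuracy pPlus θs (stateAt A h n).query)
    (M n : ℕ) (h : ℕ → Bool) :
    ∫⁻ ω in cylinder Y n h, ∑ m ∈ range M, running A (fun i => Y i ω) (n + m) ∂P ≤
      P (cylinder Y n h) *
        ENNReal.ofReal (potential (A.tauHor A.δ A.ε) Φ B D θs (stateAt A h n)) := by
  -- Peels off the first comparison; the history must vary, since the remaining M are counted from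
  -- each of its two extensions.
  induction M generalizing n h with
  | zero => simp
  | succ M ih =>
    have hmeas := measurableSet_cylinder hY.measurable n h
    have hstate : ∀ ω ∈ cylinder Y n h, stateAt A (fun i => Y i ω) n = stateAt A h n :=
      fun ω hω => stateAt_congr A hω
    by_cases hh : (stateAt A h n).halted
    · rw [setLIntegral_congr_fun hmeas (g := fun _ => 0) fun ω hω =>
        sum_eq_zero fun m _ => running_of_halted (by rwa [hstate ω hω]) m]
      simp
    -- `hacc` speaks only of histories of positive probability.
    by_cases hnull : P (cylinder Y n h) = 0
    · rw [setLIntegral_measure_zero _ _ hnull]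
      exact zero_le
    set N := A.tauHor A.δ A.ε with hNdef
    set st := stateAt A h n with hst
    set q := (pPlus st.query : ℝ) with hq
    have hq₀ : 0 ≤ q := (pPlus _).2.1
    have hq₁ : 0 ≤ 1 - q := sub_nonneg.mpr (pPlus _).2.2
    have hvalid : st.Valid A β := valid_stateAt hN hρ h n hh
    obtain ⟨ht₀, ht⟩ := potential_step_bounds (θs := θs) hvalid hh hD hB₀ hΦ hB true
    obtain ⟨hf₀, hf⟩ := potential_step_bounds (θs := θs) hvalid hh hD hB₀ hΦ hB false
    have hdrift : 1 + q * potential N Φ B D θs (step A st true) +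
        (1 - q) * potential N Φ B D θs (step A st false) ≤ potential N Φ B D θs st := by
      have h1 := mul_le_mul_of_nonneg_left ht hq₀
      have h2 := mul_le_mul_of_nonneg_left hf hq₁
      have h3 := runPotential_drift (N := N) (Φ := Φ) (B := B) hD (hacc n h hnull hh) st.k st.s st.S
      have h4 : potential N Φ B D θs st =
          runPotential N Φ B D (direction θs st.query) st.k st.s st.S := if_neg hh
      linarith
    have hbranch : ∀ b : Bool,
        ∫⁻ ω in cylinder Y (n + 1) (Function.update h n b),
          ∑ m ∈ range M, running A (fun i => Y i ω) (n + (m + 1)) ∂P ≤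
        P (cylinder Y (n + 1) (Function.update h n b)) *
          ENNReal.ofReal (potential N Φ B D θs (step A st b)) := by
      intro b
      have := ih (n + 1) (Function.update h n b)
      rw [stateAt_succ_update] at this
      simpa only [add_assoc, add_comm 1] using this
    calc ∫⁻ ω in cylinder Y n h, ∑ m ∈ range (M + 1), running A (fun i => Y i ω) (n + m) ∂P
        = ∫⁻ ω in cylinder Y n h,
            (1 + ∑ m ∈ range M, running A (fun i => Y i ω) (n + (m + 1))) ∂P := by
          refine setLIntegral_congr_fun hmeas fun ω hω => ?_
          simp only [sum_range_succ', add_zero]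
          rw [add_comm]
          congr 1
          rw [running, hstate ω hω, if_neg hh]
      _ = P (cylinder Y n h) + ∫⁻ ω in cylinder Y n h,
            ∑ m ∈ range M, running A (fun i => Y i ω) (n + (m + 1)) ∂P := by
          rw [lintegral_add_left measurable_const, setLIntegral_const, one_mul]
      _ ≤ P (cylinder Y n h) +
            (P (cylinder Y (n + 1) (Function.update h n true)) *
                ENNReal.ofReal (potential N Φ B D θs (step A st true)) +
              P (cylinder Y (n + 1) (Function.update h n false)) *
                ENNReal.ofReal (potential N Φ B D θs (step A st false))) := by
          gcongr
          rw [cylinder_eq_union]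
          exact (lintegral_union_le _ _ _).trans (add_le_add (hbranch true) (hbranch false))
      _ = P (cylinder Y n h) * ENNReal.ofReal (1 + q * potential N Φ B D θs (step A st true) +
            (1 - q) * potential N Φ B D θs (step A st false)) := by
          rw [hY.measure_cylinder_true hh, hY.measure_cylinder_false hh,
            ENNReal.ofReal_add (by positivity) (by positivity),
            ENNReal.ofReal_add (by positivity) (by positivity), ENNReal.ofReal_mul hq₀,
            ENNReal.ofReal_mul hq₁, ENNReal.ofReal_one]
          ring
      _ ≤ _ := by gcongr

theorem IsRun.lintegral_numComparisons_le [IsProbabilityMeasure P] (hY : IsRun P A pPlus Y)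
    {β Φ B D θs : ℝ} (hN : 0 < A.tauHor A.δ A.ε) (hρ : ∀ x ∉ Set.Icc (-β) β, A.ρ₀ x = 0)
    (hD : 0 < D) (hB₀ : 0 ≤ B) (hΦ : 2 / D * B ≤ Φ)
    (hB : ∀ s : ℕ, threshold A.η s + 1 ≤ B + D / 2 * s)
    (hacc : ∀ n h, P (cylinder Y n h) ≠ 0 → ¬ (stateAt A h n).halted →
      (1 + D) / 2 ≤ accuracy pPlus θs (stateAt A h n).query) :
    ∫⁻ ω, (numComparisons A (fun i => Y i ω) : ENNReal) ∂P ≤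
      ENNReal.ofReal ((A.tauHor A.δ A.ε : ℝ) * Φ) := by
  have hinit : potential (A.tauHor A.δ A.ε) Φ B D θs (init A) ≤ A.tauHor A.δ A.ε * Φ := by
    simp only [potential, init, runPotential]
    push_cast
    linarith
  calc ∫⁻ ω, (numComparisons A (fun i => Y i ω) : ENNReal) ∂P
      ≤ ∫⁻ ω, ∑' n, running A (fun i => Y i ω) n ∂P :=
        lintegral_mono fun ω => numComparisons_le_tsum A _
    _ = ∑' n, ∫⁻ ω, running A (fun i => Y i ω) n ∂P :=
        lintegral_tsum fun n => (measurable_running hY.measurable n).aemeasurable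
    _ ≤ _ := by
        -- The finite-horizon bound does not depend on M.
        refine ENNReal.tsum_le_of_sum_range_le fun M => ?_
        rw [← lintegral_finsetSum _ fun n _ => measurable_running hY.measurable n]
        have hcyl : cylinder Y 0 (fun _ => false) = Set.univ := by simp [cylinder]
        have hle := hY.setLIntegral_running_le (θs := θs) hN hρ hD hB₀ hΦ hB hacc M 0
          (fun _ => false)
        simp only [hcyl, Measure.restrict_univ, measure_univ, one_mul, zero_add] at hle
        exact hle.trans (ENNReal.ofReal_le_ofReal hinit)

end Run

/-! ### Size of the horizontal rule. -/

theorem tauHor_pos {K : RateConsts} (hK : K.Admissible) (θs : ℝ) {δ : ℝ} (ε : ℝ) (hδ₀ : 0 < δ)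
    (hδ₁ : δ < 1) : 0 < tauHor K θs δ ε := by
  refine Nat.ceil_pos.mpr (lt_max_of_lt_left (lt_max_of_lt_right ?_))
  have : 0 < Real.log (8 * K.β₁ / δ) :=
    Real.log_pos ((one_lt_div hδ₀).mpr (by linarith [hK.one_le_β₁]))
  have := hK.r₁_pos
  positivity

theorem exists_tauHor_le (β : ℝ) {K : RateConsts} (hK : K.Admissible) :
    ∃ C : ℝ, 0 < C ∧ ∀ θs ∈ Set.Icc (-β) β, ∀ δ ε : ℝ,
      0 < δ → δ < 1 → 0 < ε → ε ≤ 1 → δ * ε ≤ 1 / 2 →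
      (tauHor K θs δ ε : ℝ) ≤ C * Real.log (1 / (δ * ε)) := by
  have hς := hK.ς_pos
  have hα := hK.α_pos
  have hr₁ := hK.r₁_pos
  have hr₂ := hK.r₂_pos
  have hrR := hK.rR_pos
  have hβ₁ : 0 < K.β₁ := zero_lt_one.trans_le hK.one_le_β₁
  have hβ₂ := hK.β₂_pos
  set a₀ := 4 * K.ς * (1 + K.ς) / (K.r₂ * K.α) with ha₀
  set b₀ := 2 * |Real.log (8 * β)| + 1 with hb₀
  set b₁ := 2 * |Real.log (8 * K.β₁)| + 1 with hb₁
  set b₂ := 2 * |Real.log (8 * K.β₂)| + 1 with hb₂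
  refine ⟨a₀ * b₀ + 2 / K.r₁ * b₁ + 1 / K.rR * b₂ + 2, by positivity, ?_⟩
  intro θs hθs δ ε hδ₀ hδ₁ hε₀ hε₁ hδε
  set L := Real.log (1 / (δ * ε)) with hL
  have hL₁ : 1 / 2 ≤ L := by
    have h2 : (2 : ℝ) ≤ 1 / (δ * ε) := by
      rw [le_div_iff₀ (by positivity)]
      linarith
    have := Real.log_le_log (by norm_num) h2
    linarith [Real.log_two_gt_d9]
  have hLeq : L = -Real.log δ - Real.log ε := by
    rw [hL, one_div, Real.log_inv, Real.log_mul hδ₀.ne' hε₀.ne']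
    ring
  have hlδ : Real.log δ < 0 := Real.log_neg hδ₀ hδ₁
  have hlε : Real.log ε ≤ 0 := Real.log_nonpos hε₀.le hε₁
  -- As L ≥ 1/2, a constant c is at most 2|c|L; the final `+ 2` in the witness absorbs the ceiling
  -- in the same way.
  have absorb : ∀ c : ℝ, c + L ≤ (2 * |c| + 1) * L := fun c => by
    nlinarith [le_abs_self c, abs_nonneg c]
  have bound : ∀ b : ℝ, 0 < b → Real.log (8 * b / δ) ≤ (2 * |Real.log (8 * b)| + 1) * L := by
    intro b hb
    rw [Real.log_div (by positivity) hδ₀.ne']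
    linarith [absorb (Real.log (8 * b))]
  have h₀ : 4 * K.ς * (1 + K.ς) * Real.log (8 * |θs| / (δ * ε ^ K.ς)) / (K.r₂ * K.α) ≤
      a₀ * (b₀ * L) := by
    rw [ha₀, div_mul_eq_mul_div]
    gcongr
    rcases eq_or_ne θs 0 with rfl | hθ
    -- For θ* = 0 the entry is 0, because `Real.log 0 = 0`.
    · simp only [abs_zero, mul_zero, zero_div, Real.log_zero]
      positivity
    · have hθ₀ : 0 < |θs| := abs_pos.mpr hθ
      have hle : Real.log (8 * |θs|) ≤ Real.log (8 * β) :=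
        Real.log_le_log (by positivity) (by linarith [abs_le.mpr ⟨hθs.1, hθs.2⟩])
      rw [Real.log_div (by positivity) (by positivity), Real.log_mul hδ₀.ne' (by positivity),
        Real.log_rpow hε₀]
      have : Real.log ε ≤ K.ς * Real.log ε := by nlinarith [hK.ς_le]
      linarith [absorb (Real.log (8 * β))]
  have h₁ : 2 * Real.log (8 * K.β₁ / δ) / K.r₁ ≤ 2 / K.r₁ * (b₁ * L) := by
    rw [div_mul_eq_mul_div]
    gcongr
    exact bound _ hβ₁
  have h₂ : Real.log (8 * K.β₂ / δ) / K.rR ≤ 1 / K.rR * (b₂ * L) := by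
    rw [div_mul_eq_mul_div, one_mul]
    gcongr
    exact bound _ hβ₂
  have hL₀ : 0 < L := by linarith
  have p₀ : 0 ≤ a₀ * (b₀ * L) := by positivity
  have p₁ : 0 ≤ 2 / K.r₁ * (b₁ * L) := by positivity
  have p₂ : 0 ≤ 1 / K.rR * (b₂ * L) := by positivity
  have hsum : (tauHor K θs δ ε : ℝ) ≤
      (a₀ * (b₀ * L) + 2 / K.r₁ * (b₁ * L) + 1 / K.rR * (b₂ * L)) + 1 := by
    refine le_trans (Nat.cast_le.mpr (Nat.ceil_mono ?_)) (Nat.ceil_lt_add_one (by positivity)).le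
    exact max_le (max_le (by linarith) (by linarith)) (by linarith)
  linarith

end MAPB

/-! ### Assembly of the theorem. -/

theorem mainTheorem4 (η : ℝ) (hη₀ : 0 < η) (hη₁ : η < 1) :
    ∃ c₁ c₂ : ℝ, 0 < c₁ ∧ 0 < c₂ ∧
      ∀ (β : ℝ), 0 < β → ∀ (K : MAPB.RateConsts), K.Admissible →
      ∀ (pLow : ℝ), 1 / 2 < pLow →
        -- the bound on the expected number of comparisons
        (∀ (Ω : Type*) [MeasurableSpace Ω] (P : Measure Ω) [IsProbabilityMeasure P]
            (θs : ℝ) (pPlus : ℝ → unitInterval) (δ ε a p : ℝ) (tauUp : ℝ → ℝ → ℕ∞)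
            (ρ₀ : ℝ → ℝ) (Y : ℕ → Ω → Bool),
          θs ∈ Set.Icc (-β) β →
          0 < δ → δ < 1 → 0 < ε → 0 < a →
          1 / 2 < p → p < 1 - η / 2 →
          MAPB.IsPriorDensity β ρ₀ →
          ∀ A : MAPB.Input, A = ⟨δ, ε, a, η, p, MAPB.tauHor K θs, tauUp, ρ₀⟩ →
          MAPB.IsRun P A pPlus Y →
          (∀ θ ∈ Set.Icc (-β) β, θ ≠ θs → pLow ≤ MAPB.accuracy pPlus θs θ) →
          (pLow ≤ MAPB.accuracy pPlus θs θs ∨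
            ∀ᵐ ω ∂P, ∀ n, ¬ (MAPB.stateAt A (fun i => Y i ω) n).halted →
              (MAPB.stateAt A (fun i => Y i ω) n).query ≠ θs) →
          ∫⁻ ω, (MAPB.numComparisons A (fun i => Y i ω) : ENNReal) ∂P ≤
            ENNReal.ofReal ((MAPB.tauHor K θs δ ε : ℝ) * MAPB.phi c₁ c₂ pLow)) ∧
        -- the bound is `O(log (1 / (δ ε)))`
        (∃ C : ℝ, 0 < C ∧ ∀ θs ∈ Set.Icc (-β) β, ∀ δ ε : ℝ,
          0 < δ → δ < 1 → 0 < ε → ε ≤ 1 → δ * ε ≤ 1 / 2 →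
          (MAPB.tauHor K θs δ ε : ℝ) * MAPB.phi c₁ c₂ pLow ≤ C * Real.log (1 / (δ * ε))) := by
  have hlog8 : 0 ≤ Real.log 8 := Real.log_nonneg (by norm_num)
  have hlogη : Real.log η < 0 := Real.log_neg hη₀ hη₁
  refine ⟨8 + 2 * (2 + 4 * Real.log 8 - 4 * Real.log η),
    4 * (2 + 4 * Real.log 8 - 4 * Real.log η), by linarith, by linarith, ?_⟩
  intro β hβ K hK pLow hp
  refine ⟨?_, ?_⟩
  · intro Ω _ P _ θs pPlus δ ε a p tauUp ρ₀ Y hθs hδ₀ hδ₁ _ _ _ _ hρ₀ A hA hY hacc hstar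
    have hN : 0 < A.tauHor A.δ A.ε := by
      rw [hA]
      exact MAPB.tauHor_pos hK θs ε hδ₀ hδ₁
    have hzero : ∀ x ∉ Set.Icc (-β) β, A.ρ₀ x = 0 := by
      rw [hA]
      exact hρ₀.zero
    have hη : A.η = η := by rw [hA]
    -- Some point of Θ differs from θ*, and its accuracy is a probability.
    have hpLow : pLow ≤ 1 := by
      obtain ⟨θ, hθ, hne⟩ : ∃ θ ∈ Set.Icc (-β) β, θ ≠ θs :=
        by
        rcases eq_or_ne θs β with rfl | hne
        · exact ⟨0, ⟨by linarith, hβ.le⟩, hβ.ne⟩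
        · exact ⟨β, ⟨by linarith, le_rfl⟩, hne.symm⟩
      have hle := hacc θ hθ hne
      unfold MAPB.accuracy at hle
      split_ifs at hle
      · linarith [(pPlus θ).2.2]
      · linarith [(pPlus θ).2.1]
    set D := 2 * pLow - 1 with hD
    have hD₀ : 0 < D := by linarith
    have hD₁ : D ≤ 1 := by linarith
    have hlogD : 0 ≤ Real.log D⁻¹ := Real.log_nonneg ((one_le_inv₀ hD₀).mpr hD₁)
    have hB₀ : 0 ≤ 1 + 2 / D * (Real.log 8 + 2 * Real.log D⁻¹ - Real.log η) := by
      have : 0 ≤ Real.log 8 + 2 * Real.log D⁻¹ - Real.log η := by linarith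
      positivity
    have hmain := hY.lintegral_numComparisons_le (θs := θs) hN hzero hD₀ hB₀
      (MAPB.offset_le_phi hη₀ hη₁ hD₀ hD₁)
      (fun s => by
        rw [hη]
        linarith [MAPB.threshold_le hη₀ hη₁ hD₀ hD₁ s])
      (by
        intro n h hpos hh
        have hquery : (MAPB.stateAt A h n).query ∈ Set.Icc (-β) β :=
          MAPB.median_mem_Icc hβ (MAPB.valid_stateAt hN hzero h n hh).zero
        have hhalf : (1 + D) / 2 = pLow := by rw [hD]; ring
        rw [hhalf]
        by_cases hne : (MAPB.stateAt A h n).query = θs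
        · rcases hstar with hstar | hstar
          · rwa [hne]
          -- A history of positive probability contains an outcome on which the almost sure property
          -- holds.
          · obtain ⟨ω, hω, hnot⟩ :=
              (frequently_ae_mem_iff.mpr hpos).and_eventually hstar |>.exists
            have hst : MAPB.stateAt A (fun i => Y i ω) n = MAPB.stateAt A h n :=
              MAPB.stateAt_congr A hω
            have := hnot n
            rw [hst] at this
            exact absurd hne (this hh)
        · exact hacc _ hquery hne)
    have hτ : A.tauHor A.δ A.ε = MAPB.tauHor K θs δ ε := by rw [hA]
    rwa [hτ, ← abs_of_pos hD₀] at hmain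
  · obtain ⟨C, hC, hle⟩ := MAPB.exists_tauHor_le β hK
    set Φ := MAPB.phi (8 + 2 * (2 + 4 * Real.log 8 - 4 * Real.log η))
      (4 * (2 + 4 * Real.log 8 - 4 * Real.log η)) pLow
    -- Here pLow > 1 is allowed and the logarithm in Φ may be negative; `|Φ| + 1` avoids any
    -- discussion of signs.
    refine ⟨C * (|Φ| + 1), by positivity, ?_⟩
    intro θs hθs δ ε hδ₀ hδ₁ hε₀ hε₁ hδε
    have hτ := hle θs hθs δ ε hδ₀ hδ₁ hε₀ hε₁ hδε
    have hnn : (0 : ℝ) ≤ MAPB.tauHor K θs δ ε := Nat.cast_nonneg _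
    calc (MAPB.tauHor K θs δ ε : ℝ) * Φ ≤ MAPB.tauHor K θs δ ε * (|Φ| + 1) := by
          gcongr
          linarith [le_abs_self Φ]
      _ ≤ C * Real.log (1 / (δ * ε)) * (|Φ| + 1) := by gcongr
      _ = _ := by ring
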